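/- There is an absolute constant $c\in(0,\infty)$ such that the following holds. Let $n\ge 1$, let $X_1,\dots,X_n$ be independent random variables with values in a Banach space $E$, and suppose that they regularly cover an $E$-valued random variable $\tilde X_1$, that is, $$E[g(\tilde X_1)]=\frac1n\sum_{k=1}^n E[g(X_k)]$$ for all Borel functions $g$ on $E$ for which either side is defined (equivalently, the law of $\tilde X_1$ is the average $\frac1n\sum_{k=1}^n \mathrm{law}(X_k)$). Let $\tilde X_2,\dots,\tilde X_n$ be copies of $\tilde X_1$ (random variables with the same distribution as $\tilde X_1$) such that $\tilde X_1,\dots,\tilde X_n$ are independent. Then $$P(\|X_1+\dots+X_n\|\ge\lambda)\le c\,P(\|\tilde X_1+\dots+\tilde X_n\|\ge\lambda/c)\qquad\text{for all }\lambda\ge 0.$$ -/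

import Mathlib

open MeasureTheory ProbabilityTheory
open scoped ENNReal

/-- The variables `X 0, …, X (n-1)` (on the probability space `(Ω, μ)`) regularly cover the
variable `Y` (on `(Ω', ν)`): `E[g(Y)] = (1/n) ∑ₖ E[g(Xₖ)]` for all Borel functions `g`.
The expectations of nonnegative extended-valued Borel functions are always defined, and they
determine all others, by splitting `g` into its positive and negative parts. -/
def RegularlyCovers {Ω Ω' E : Type*} [MeasurableSpace Ω] [MeasurableSpace Ω']
    [MeasurableSpace E] {n : ℕ} (X : Fin n → Ω → E) (μ : Measure Ω)
    (Y : Ω' → E) (ν : Measure Ω') : Prop :=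
  ∀ g : E → ℝ≥0∞, Measurable g →
    ∫⁻ ω, g (Y ω) ∂ν = (n : ℝ≥0∞)⁻¹ * ∑ k : Fin n, ∫⁻ ω, g (X k ω) ∂μ

/-!
The theorem holds with `c = 104`. Write `S = X₁ + ⋯ + Xₙ`, let `T` be the sum of the `n` independent
copies of the covering variable, and put `p = P(‖T‖ ≥ t)`.

Sampling. Each summand of `T` amounts to picking an index uniformly and then drawing from the law of
the corresponding `X`. So the law of `T` is the uniform mixture, over all maps `f` of the index set
to itself, of the laws of the sums of independent draws from the laws of `X_{f 1}, …, X_{f n}`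
(`normTail_sumLaw_average`). Redrawing some of the summands of such a sum, at most one for each
index in the range of `f`, does not change its law; hence the symmetrized sum `∑ (Xₖ - Xₖ')` over any
subset of the range of `f` is a difference of two variables with that law
(`symNormTail_sumLaw_comp_le`). With probability at least `1/4` the range of `f` contains at least
half of the indices (`card_filter_card_image_ge`). Two relabelings of such a range cover all indices,
and averaging over all relabelings gives `P(‖S - S'‖ ≥ 4t) ≤ 16 p` for an independent copy `S'` of
`S` (`symNormTail_sumLaw_le`). By Fubini there is a vector `a` with `P(‖S - a‖ ≥ 4t) ≤ 16 p`.

Centering. It remains to see that `‖a‖ < 100 t`, where one may assume `p < 1/100`, the claim being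
trivial otherwise (`norm_center_lt`). Apply a functional `φ` of norm at most one with `φ a = ‖a‖`,
and let `χₖ` be the characteristic function of `φ Xₖ`. That of `φ T` is `(n⁻¹ ∑ χₖ) ^ n`, and it is
close to `1` on all of `[0, π / ‖a‖]` if `‖a‖ ≥ 100 t`. By continuity `∑ (1 - χₖ)` is then small on
that interval. As `|1 - χₖ|² ≤ 2 Re (1 - χₖ)`, the product `∏ χₖ` is close to `exp (-∑ (1 - χₖ))`, so
to `1` (`norm_prod_sub_one_le_of_average_pow`). But it is the characteristic function of `φ S`,
which is concentrated near `‖a‖`, and at `π / ‖a‖` its value is close to `exp (iπ) = -1`.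
-/

/-! ### Products of complex numbers close to one -/

theorem norm_prod_sub_prod_le_sum {ι : Type*} (s : Finset ι) (a b : ι → ℂ)
    (ha : ∀ i ∈ s, ‖a i‖ ≤ 1) (hb : ∀ i ∈ s, ‖b i‖ ≤ 1) :
    ‖∏ i ∈ s, a i - ∏ i ∈ s, b i‖ ≤ ∑ i ∈ s, ‖a i - b i‖ := by
  classical
  induction s using Finset.induction_on with
  | empty => simp
  | insert j s hj ih =>
    rw [Finset.prod_insert hj, Finset.prod_insert hj, Finset.sum_insert hj]
    have hP : ‖∏ i ∈ s, b i‖ ≤ 1 := by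
      rw [norm_prod]
      exact Finset.prod_le_one (fun _ _ ↦ norm_nonneg _)
        fun i hi ↦ hb i (Finset.mem_insert_of_mem hi)
    have ih' := ih (fun i hi ↦ ha i (Finset.mem_insert_of_mem hi))
      (fun i hi ↦ hb i (Finset.mem_insert_of_mem hi))
    have haj := ha j (Finset.mem_insert_self j s)
    calc ‖a j * ∏ i ∈ s, a i - b j * ∏ i ∈ s, b i‖
        = ‖(a j - b j) * ∏ i ∈ s, b i + a j * (∏ i ∈ s, a i - ∏ i ∈ s, b i)‖ := by ring_nf
      _ ≤ ‖a j - b j‖ * ‖∏ i ∈ s, b i‖ + ‖a j‖ * ‖∏ i ∈ s, a i - ∏ i ∈ s, b i‖ := by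
          rw [← norm_mul, ← norm_mul]; exact norm_add_le _ _
      _ ≤ ‖a j - b j‖ * 1 + 1 * ∑ i ∈ s, ‖a i - b i‖ := by gcongr
      _ = _ := by ring

/-- For `z` in the disc of radius one about `1`, the real part controls the modulus. -/
theorem norm_sq_le_two_mul_re {z : ℂ} (hz : ‖1 - z‖ ≤ 1) : ‖z‖ ^ 2 ≤ 2 * z.re := by
  have h : ‖1 - z‖ ^ 2 ≤ 1 := pow_le_one₀ (norm_nonneg _) hz
  rw [← Complex.normSq_eq_norm_sq, Complex.normSq_apply] at h ⊢
  simp only [Complex.sub_re, Complex.sub_im, Complex.one_re, Complex.one_im] at h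
  nlinarith

theorem norm_prod_one_sub_sub_exp_le {ι : Type*} (s : Finset ι) (z : ι → ℂ)
    (h1 : ∀ i ∈ s, ‖1 - z i‖ ≤ 1) (hz : ∀ i ∈ s, ‖z i‖ ≤ 1) :
    ‖∏ i ∈ s, (1 - z i) - Complex.exp (-∑ i ∈ s, z i)‖ ≤ ∑ i ∈ s, ‖z i‖ ^ 2 := by
  rw [← Finset.sum_neg_distrib, Complex.exp_sum]
  refine (norm_prod_sub_prod_le_sum s _ _ h1 fun i hi ↦ ?_).trans
    (Finset.sum_le_sum fun i hi ↦ ?_)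
  · rw [Complex.norm_exp, Real.exp_le_one_iff, Complex.neg_re]
    nlinarith [norm_sq_le_two_mul_re (h1 i hi), sq_nonneg ‖z i‖]
  · have := Complex.norm_exp_sub_one_sub_id_le (x := -z i) (by simpa using hz i hi)
    rw [norm_neg] at this
    rwa [norm_sub_rev, show Complex.exp (-z i) - (1 - z i) = Complex.exp (-z i) - 1 - -z i by ring]

/-- If the `n`-th power of the average of the `χ k` stays close to `1` along the whole interval
`[0, U]`, then so does the product of the `χ k`. Closeness at a single point would not suffice:
the average could be close to another `n`-th root of unity. -/
theorem norm_prod_sub_one_le_of_average_pow {n : ℕ} [NeZero n] (χ : Fin n → ℝ → ℂ)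
    (hcont : ∀ k, Continuous (χ k)) (hzero : ∀ k, χ k 0 = 1) (hle : ∀ k u, ‖χ k u‖ ≤ 1)
    {U : ℝ}
    (hU : ∀ u ∈ Set.Icc 0 U, ‖((n : ℂ)⁻¹ * ∑ k, χ k u) ^ n - 1‖ ≤ 3 / 50) :
    ∀ u ∈ Set.Icc 0 U, ‖∏ k, χ k u - 1‖ ≤ 1 / 2 := by
  have hn : (n : ℂ) ≠ 0 := Nat.cast_ne_zero.2 (NeZero.ne n)
  have hn1 : (1 : ℝ) ≤ n := by exact_mod_cast NeZero.one_le
  set Z : ℝ → ℂ := fun u ↦ ∑ k, (1 - χ k u) with hZ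
  have hZcont : Continuous Z := by fun_prop
  have hψ (u) : (n : ℂ)⁻¹ * ∑ k, χ k u = 1 - Z u / n := by
    simp only [hZ, Finset.sum_sub_distrib, Finset.sum_const, Finset.card_univ, Fintype.card_fin,
      nsmul_eq_mul, mul_one]
    field_simp
    ring
  have hψle (u) : ‖1 - Z u / n‖ ≤ 1 := by
    rw [← hψ, norm_mul, norm_inv, Complex.norm_natCast]
    calc (n : ℝ)⁻¹ * ‖∑ k, χ k u‖ ≤ (n : ℝ)⁻¹ * ∑ k : Fin n, 1 := by
          gcongr
          exact norm_sum_le_of_le _ fun k _ ↦ hle k u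
      _ = 1 := by simp
  -- `‖Z u‖` cannot take the value `1/8`, as the `n`-th power would then differ from `1` too much.
  have hne : ∀ u ∈ Set.Icc 0 U, ‖Z u‖ ≠ 1 / 8 := by
    intro u hu h
    have hz : ‖Z u / n‖ ≤ 1 := by
      rw [norm_div, Complex.norm_natCast, h]
      exact div_le_one_of_le₀ (by linarith) (by positivity)
    have key := norm_prod_one_sub_sub_exp_le (Finset.univ : Finset (Fin n)) (fun _ ↦ Z u / n)
      (fun _ _ ↦ hψle u) (fun _ _ ↦ hz)
    simp only [Finset.prod_const, Finset.card_univ, Fintype.card_fin, Finset.sum_const,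
      nsmul_eq_mul, mul_div_cancel₀ _ hn] at key
    have hsq : (n : ℝ) * ‖Z u / n‖ ^ 2 ≤ 1 / 64 := by
      rw [norm_div, Complex.norm_natCast, h, div_pow, mul_div_assoc', div_le_iff₀ (by positivity)]
      nlinarith
    have he := Complex.norm_exp_sub_one_sub_id_le (x := -Z u) (by rw [norm_neg, h]; norm_num)
    rw [norm_neg, h] at he
    have hUu := hU u hu
    rw [hψ] at hUu
    have : ‖Z u‖ ≤ ‖(1 - Z u / n) ^ n - Complex.exp (-Z u)‖ +
        ‖Complex.exp (-Z u) - 1 - -Z u‖ + ‖(1 - Z u / n) ^ n - 1‖ := by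
      calc ‖Z u‖ = ‖((1 - Z u / n) ^ n - Complex.exp (-Z u)) +
            (Complex.exp (-Z u) - 1 - -Z u) - ((1 - Z u / n) ^ n - 1)‖ := by ring_nf
        _ ≤ _ := (norm_sub_le _ _).trans (by gcongr; exact norm_add_le _ _)
    linarith
  intro u hu
  have hlt : ‖Z u‖ < 1 / 8 := by
    by_contra! h
    obtain ⟨v, hv, hv'⟩ := intermediate_value_Icc hu.1 hZcont.norm.continuousOn
      (show (1 / 8 : ℝ) ∈ Set.Icc ‖Z 0‖ ‖Z u‖ from ⟨by simp [hZ, hzero], h⟩)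
    exact hne v ⟨hv.1, hv.2.trans hu.2⟩ hv'
  have h1 : ∀ k, ‖1 - (1 - χ k u)‖ ≤ 1 := fun k ↦ by simpa using hle k u
  have hre : ∑ k, ‖1 - χ k u‖ ^ 2 ≤ 1 / 4 := by
    calc ∑ k, ‖1 - χ k u‖ ^ 2 ≤ ∑ k, 2 * (1 - χ k u).re :=
          Finset.sum_le_sum fun k _ ↦ norm_sq_le_two_mul_re (h1 k)
      _ = 2 * (Z u).re := by rw [← Finset.mul_sum, hZ, Complex.re_sum]
      _ ≤ 1 / 4 := by linarith [Complex.re_le_norm (Z u)]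
  have hz : ∀ k, ‖1 - χ k u‖ ≤ 1 := by
    intro k
    have : ‖1 - χ k u‖ ^ 2 ≤ 1 / 4 := (Finset.single_le_sum (f := fun k ↦ ‖1 - χ k u‖ ^ 2)
      (fun _ _ ↦ sq_nonneg _) (Finset.mem_univ k)).trans hre
    nlinarith [norm_nonneg (1 - χ k u)]
  have key := norm_prod_one_sub_sub_exp_le Finset.univ (fun k ↦ 1 - χ k u)
    (fun k _ ↦ h1 k) (fun k _ ↦ hz k)
  simp only [sub_sub_cancel] at key
  have he := Complex.norm_exp_sub_one_le (x := -Z u) (by rw [norm_neg]; linarith)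
  rw [norm_neg] at he
  calc ‖∏ k, χ k u - 1‖ = ‖(∏ k, χ k u - Complex.exp (-Z u)) + (Complex.exp (-Z u) - 1)‖ := by
        ring_nf
    _ ≤ 1 / 4 + 2 * (1 / 8) := (norm_add_le _ _).trans (by gcongr <;> linarith)
    _ = 1 / 2 := by norm_num

/-! ### The range of a random self-map of a finite set -/

theorem sub_one_pow_self_le (n : ℕ) [NeZero n] :
    ((n : ℝ) - 1) ^ n ≤ 3 / 8 * (n : ℝ) ^ n := by
  have hn : (1 : ℝ) ≤ n := by exact_mod_cast NeZero.one_le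
  have h := Real.one_sub_div_pow_le_exp_neg (n := n) (t := 1) hn
  have he : Real.exp (-1) ≤ 3 / 8 := by
    rw [Real.exp_neg, inv_le_comm₀ (Real.exp_pos _) (by norm_num)]
    linarith [Real.exp_one_gt_d9]
  calc ((n : ℝ) - 1) ^ n = (1 - 1 / n) ^ n * (n : ℝ) ^ n := by
        rw [← mul_pow]; congr 1; field_simp
    _ ≤ 3 / 8 * (n : ℝ) ^ n := by gcongr; exact h.trans he

/-- At least a quarter of all maps from an `n`-point set to itself hit at least half of the
points: the expected number of missed points is `n (1 - 1/n) ^ n ≤ n / e`. -/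
theorem card_filter_card_image_ge (n : ℕ) [NeZero n] :
    (n : ℝ) ^ n / 4 ≤
      (Finset.univ.filter fun f : Fin n → Fin n ↦ n ≤ 2 * (Finset.univ.image f).card).card := by
  have hn : (1 : ℝ) ≤ n := by exact_mod_cast NeZero.one_le
  set good := Finset.univ.filter fun f : Fin n → Fin n ↦ n ≤ 2 * (Finset.univ.image f).card
  have hmiss : ∑ f : Fin n → Fin n, ((Finset.univ.image f)ᶜ.card : ℝ) = n * ((n : ℝ) - 1) ^ n := by
    have h1 (f : Fin n → Fin n) : ((Finset.univ.image f)ᶜ.card : ℝ) =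
        ∑ k, if ∀ i, f i ≠ k then (1 : ℝ) else 0 := by
      rw [Finset.sum_boole]
      congr 2
      ext k
      simp
    have h2 (k : Fin n) : (∑ f : Fin n → Fin n, if ∀ i, f i ≠ k then (1 : ℝ) else 0) =
        ((n : ℝ) - 1) ^ n := by
      rw [Finset.sum_boole]
      have : (Finset.univ.filter fun f : Fin n → Fin n ↦ ∀ i, f i ≠ k) =
          Fintype.piFinset fun _ ↦ Finset.univ.erase k := by
        ext f; simp [Fintype.mem_piFinset]
      rw [this, Fintype.card_piFinset]
      simp [Nat.cast_sub (NeZero.one_le : 1 ≤ n)]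
    simp_rw [h1]
    rw [Finset.sum_comm]
    simp [h2]
  have hbad : (goodᶜ.card : ℝ) * n ≤ 2 * (n * ((n : ℝ) - 1) ^ n) := by
    rw [← hmiss, Finset.mul_sum, ← nsmul_eq_mul, ← Finset.sum_const]
    refine (Finset.sum_le_sum fun f hf ↦ ?_).trans
      (Finset.sum_le_sum_of_subset_of_nonneg (Finset.subset_univ goodᶜ)
        fun _ _ _ ↦ by positivity)
    have hf' : 2 * (Finset.univ.image f).card < n := by simpa [good] using hf
    rw [Finset.card_compl, Fintype.card_fin]
    have : n ≤ 2 * (n - (Finset.univ.image f).card) := by omega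
    exact_mod_cast this
  have hbad' : (goodᶜ.card : ℝ) ≤ 2 * ((n : ℝ) - 1) ^ n := by
    nlinarith
  have htot : (good.card : ℝ) + goodᶜ.card = (n : ℝ) ^ n := by
    have := Finset.card_add_card_compl good
    rw [Fintype.card_fun, Fintype.card_fin] at this
    exact_mod_cast this
  linarith [sub_one_pow_self_le n]

/-- If a map hits at least half of the points, the points it misses can be moved into its range
by a permutation. -/
theorem exists_perm_of_card_image_ge {n : ℕ} (f : Fin n → Fin n)
    (hf : n ≤ 2 * (Finset.univ.image f).card) :
    ∃ τ : Equiv.Perm (Fin n), ∀ k ∉ Set.range f, k ∈ Set.range (τ ∘ f) := by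
  classical
  have hcard : Fintype.card ((Finset.univ.image f)ᶜ : Finset (Fin n)) ≤
      Fintype.card (Finset.univ.image f : Finset (Fin n)) := by
    rw [Fintype.card_coe, Fintype.card_coe, Finset.card_compl, Fintype.card_fin]
    omega
  obtain ⟨e⟩ := Function.Embedding.nonempty_of_card_le hcard
  obtain ⟨τ, hτ⟩ := Equiv.Perm.exists_extending_pair (fun k ↦ (e k : Fin n)) Subtype.val
    (Subtype.val_injective.comp e.injective) Subtype.val_injective
  refine ⟨τ, fun k hk ↦ ?_⟩
  have hk' : k ∈ (Finset.univ.image f)ᶜ := by simpa using hk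
  obtain ⟨i, -, hi⟩ := Finset.mem_image.1 (e ⟨k, hk'⟩).2
  exact ⟨i, by rw [Function.comp_apply, hi, hτ]⟩

/-! ### Laws of sums of independent variables, and their tails -/

section Laws

variable {E : Type*} [NormedAddCommGroup E] [MeasurableSpace E]

/-- The law of `∑ i, ξ i`, where the `ξ i` are independent with laws `m i`. -/
noncomputable def sumLaw {ι : Type*} [Fintype ι] (m : ι → Measure E) : Measure E :=
  (Measure.pi m).map fun x ↦ ∑ i, x i

/-- The probability that a variable with law `ρ` has norm at least `t`. -/
noncomputable def normTail (ρ : Measure E) (t : ℝ) : ℝ := ρ.real {x | t ≤ ‖x‖}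

/-- The probability that two independent variables with law `ρ` have distance at least `t`. -/
noncomputable def symNormTail (ρ : Measure E) (t : ℝ) : ℝ :=
  (ρ.prod ρ).real {x | t ≤ ‖x.1 - x.2‖}

variable [BorelSpace E]

theorem integrable_exp_dual_mul_I [NormedSpace ℝ E] (ρ : Measure E) [IsFiniteMeasure ρ]
    (L : StrongDual ℝ E) : Integrable (fun x ↦ Complex.exp (L x * Complex.I)) ρ :=
  (integrable_const (1 : ℝ)).mono (by fun_prop) (by simp [Complex.norm_exp_ofReal_mul_I])

theorem charFunDual_average [NormedSpace ℝ E] {n : ℕ} (m : Fin n → Measure E)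
    [∀ k, IsProbabilityMeasure (m k)] (mbar : Measure E)
    (hbar : mbar = (n : ℝ≥0∞)⁻¹ • ∑ k, m k) (L : StrongDual ℝ E) :
    charFunDual mbar L = (n : ℂ)⁻¹ * ∑ k, charFunDual (m k) L := by
  rw [hbar, charFunDual_apply, integral_smul_measure,
    integral_finsetSum_measure fun k _ ↦ integrable_exp_dual_mul_I _ _]
  simp [charFunDual_apply]

/-- A law that puts most of its mass near `a` has a characteristic function close to that of the
point mass at `a`. -/
theorem norm_charFunDual_sub_exp_le [NormedSpace ℝ E] (ρ : Measure E) [IsProbabilityMeasure ρ]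
    (L : StrongDual ℝ E) (a : E) {s : ℝ} (hs : 0 ≤ s) :
    ‖charFunDual ρ L - Complex.exp (L a * Complex.I)‖ ≤
      ‖L‖ * s + 2 * ρ.real {x | s ≤ ‖x - a‖} := by
  have hS : MeasurableSet {x : E | s ≤ ‖x - a‖} :=
    measurableSet_le measurable_const (by fun_prop)
  rw [charFunDual_apply]
  have h1 : ∫ x, Complex.exp (L x * Complex.I) ∂ρ - Complex.exp (L a * Complex.I) =
      ∫ x, (Complex.exp (L x * Complex.I) - Complex.exp (L a * Complex.I)) ∂ρ := by
    rw [integral_sub (integrable_exp_dual_mul_I ρ L) (integrable_const _)]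
    simp
  have h2 : ∫ x, (‖L‖ * s + {x | s ≤ ‖x - a‖}.indicator (fun _ ↦ (2 : ℝ)) x) ∂ρ =
      ‖L‖ * s + 2 * ρ.real {x | s ≤ ‖x - a‖} := by
    rw [integral_add (integrable_const _) ((integrable_const _).indicator hS),
      integral_indicator_const _ hS]
    simp [mul_comm]
  rw [h1, ← h2]
  refine norm_integral_le_of_norm_le
    ((integrable_const _).add ((integrable_const _).indicator hS)) (ae_of_all _ fun x ↦ ?_)
  by_cases hx : s ≤ ‖x - a‖
  · have : ‖Complex.exp (L x * Complex.I) - Complex.exp (L a * Complex.I)‖ ≤ 1 + 1 := by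
      refine (norm_sub_le _ _).trans ?_
      rw [Complex.norm_exp_ofReal_mul_I, Complex.norm_exp_ofReal_mul_I]
    rw [Set.indicator_of_mem (by exact hx)]
    have : 0 ≤ ‖L‖ * s := by positivity
    linarith
  · rw [Set.indicator_of_notMem (by exact hx), add_zero]
    have h3 : Complex.exp (L x * Complex.I) - Complex.exp (L a * Complex.I) =
        Complex.exp (L a * Complex.I) * (Complex.exp (Complex.I * (L (x - a) : ℝ)) - 1) := by
      rw [mul_sub, ← Complex.exp_add, map_sub]
      push_cast
      ring_nf
    rw [h3, norm_mul, Complex.norm_exp_ofReal_mul_I, one_mul]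
    calc ‖Complex.exp (Complex.I * (L (x - a) : ℝ)) - 1‖ ≤ ‖L (x - a)‖ :=
          Real.norm_exp_I_mul_ofReal_sub_one_le
      _ ≤ ‖L‖ * ‖x - a‖ := L.le_opNorm _
      _ ≤ ‖L‖ * s := by gcongr; exact (not_le.1 hx).le

variable [SecondCountableTopology E]

instance {ι κ : Type*} (m : ι → Measure E) [h : ∀ i, IsProbabilityMeasure (m i)] (g : κ → ι)
    (k : κ) : IsProbabilityMeasure ((m ∘ g) k) :=
  h (g k)

instance sumLaw.isProbabilityMeasure {ι : Type*} [Fintype ι] (m : ι → Measure E)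
    [∀ i, IsProbabilityMeasure (m i)] : IsProbabilityMeasure (sumLaw m) :=
  Measure.isProbabilityMeasure_map (by fun_prop)

/-- Two variables `U + V` and `U' + V` with law `ν ∗ ρ` that share their second part have
difference `U - U'`. -/
theorem symNormTail_two_mul_le (ν ρ : Measure E) [IsProbabilityMeasure ν]
    [IsProbabilityMeasure ρ] (t : ℝ) : symNormTail ν (2 * t) ≤ 2 * normTail (ν ∗ ρ) t := by
  set P := (ν.prod ν).prod ρ
  have hS : MeasurableSet {x : E | t ≤ ‖x‖} := measurableSet_le measurable_const measurable_norm
  have h1 : normTail (ν ∗ ρ) t = P.real {x | t ≤ ‖x.1.1 + x.2‖} := by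
    have : (ν ∗ ρ) = P.map fun x ↦ x.1.1 + x.2 := by
      rw [Measure.conv, show (fun x : (E × E) × E ↦ x.1.1 + x.2) =
        (fun y : E × E ↦ y.1 + y.2) ∘ Prod.map Prod.fst id from rfl,
        ← Measure.map_map (by fun_prop) (by fun_prop),
        ← Measure.map_prod_map _ _ measurable_fst measurable_id]
      simp [Measure.map_fst_prod]
    rw [normTail, this, map_measureReal_apply (by fun_prop) hS]
    rfl
  have h2 : normTail (ν ∗ ρ) t = P.real {x | t ≤ ‖x.1.2 + x.2‖} := by
    have : (ν ∗ ρ) = P.map fun x ↦ x.1.2 + x.2 := by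
      rw [Measure.conv, show (fun x : (E × E) × E ↦ x.1.2 + x.2) =
        (fun y : E × E ↦ y.1 + y.2) ∘ Prod.map Prod.snd id from rfl,
        ← Measure.map_map (by fun_prop) (by fun_prop),
        ← Measure.map_prod_map _ _ measurable_snd measurable_id]
      simp [Measure.map_snd_prod]
    rw [normTail, this, map_measureReal_apply (by fun_prop) hS]
    rfl
  have h3 : symNormTail ν (2 * t) = P.real {x | 2 * t ≤ ‖x.1.1 - x.1.2‖} := by
    have : ν.prod ν = P.map Prod.fst := by simp [P, Measure.map_fst_prod]
    rw [symNormTail, this, map_measureReal_apply (by fun_prop)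
      (measurableSet_le measurable_const (by fun_prop))]
    rfl
  rw [two_mul (normTail _ _)]
  nth_rewrite 1 [h1]
  rw [h2, h3]
  refine (measureReal_mono fun x hx ↦ ?_).trans
    (measureReal_union_le _ _)
  by_contra! h
  simp only [Set.mem_union, Set.mem_ofPred_eq, not_or, not_le] at h hx
  have := norm_sub_le (x.1.1 + x.2) (x.1.2 + x.2)
  rw [add_sub_add_right_eq_sub] at this
  linarith

theorem symNormTail_conv_le (ν ρ : Measure E) [IsProbabilityMeasure ν]
    [IsProbabilityMeasure ρ] (s t : ℝ) :
    symNormTail (ν ∗ ρ) (s + t) ≤ symNormTail ν s + symNormTail ρ t := by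
  set P := (ν.prod ρ).prod (ν.prod ρ)
  have h1 : (ν ∗ ρ).prod (ν ∗ ρ) =
      P.map fun x ↦ (x.1.1 + x.1.2, x.2.1 + x.2.2) := by
    rw [Measure.conv, Measure.map_prod_map _ _ (by fun_prop) (by fun_prop)]
    rfl
  have h2 : ν.prod ν = P.map fun x ↦ (x.1.1, x.2.1) := by
    conv_lhs => rw [show ν = (ν.prod ρ).map Prod.fst by simp [Measure.map_fst_prod]]
    rw [Measure.map_prod_map _ _ (by fun_prop) (by fun_prop)]
    rfl
  have h3 : ρ.prod ρ = P.map fun x ↦ (x.1.2, x.2.2) := by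
    conv_lhs => rw [show ρ = (ν.prod ρ).map Prod.snd by simp [Measure.map_snd_prod]]
    rw [Measure.map_prod_map _ _ (by fun_prop) (by fun_prop)]
    rfl
  have hS (r : ℝ) : MeasurableSet {x : E × E | r ≤ ‖x.1 - x.2‖} :=
    measurableSet_le measurable_const (by fun_prop)
  rw [symNormTail, symNormTail, symNormTail, h1, h2, h3,
    map_measureReal_apply (by fun_prop) (hS _), map_measureReal_apply (by fun_prop) (hS _),
    map_measureReal_apply (by fun_prop) (hS _)]
  refine (measureReal_mono fun x hx ↦ ?_).trans (measureReal_union_le _ _)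
  by_contra! h
  simp only [Set.mem_union, Set.mem_preimage, Set.mem_ofPred_eq, not_or, not_le] at h hx
  have := norm_add_le (x.1.1 - x.2.1) (x.1.2 - x.2.2)
  rw [← add_sub_add_comm] at this
  linarith

/-- Conditioning on one of the two copies produces a center around which `ρ` is concentrated. -/
theorem exists_measureReal_norm_sub_le_symNormTail (ρ : Measure E) [IsProbabilityMeasure ρ]
    (t : ℝ) : ∃ a, ρ.real {x | t ≤ ‖x - a‖} ≤ symNormTail ρ t := by
  have hS : MeasurableSet {x : E × E | t ≤ ‖x.1 - x.2‖} :=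
    measurableSet_le measurable_const (by fun_prop)
  obtain ⟨a, ha⟩ := exists_le_lintegral (μ := ρ)
    (f := fun a ↦ ρ ((fun x ↦ (x, a)) ⁻¹' {x : E × E | t ≤ ‖x.1 - x.2‖}))
    (measurable_measure_prodMk_right hS).aemeasurable
  rw [← Measure.prod_apply_symm hS] at ha
  exact ⟨a, ENNReal.toReal_mono (measure_ne_top _ _) ha⟩

variable [NormedSpace ℝ E]

theorem charFunDual_sumLaw {ι : Type*} [Fintype ι] (m : ι → Measure E)
    [∀ i, IsProbabilityMeasure (m i)] (L : StrongDual ℝ E) :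
    charFunDual (sumLaw m) L = ∏ i, charFunDual (m i) L := by
  rw [sumLaw, charFunDual_map_sum_pi_eq_prod, Finset.prod_apply]

variable [CompleteSpace E]

theorem sumLaw_comp_equiv {ι κ : Type*} [Fintype ι] [Fintype κ] (m : ι → Measure E)
    [∀ i, IsProbabilityMeasure (m i)] (e : κ ≃ ι) : sumLaw (m ∘ e) = sumLaw m := by
  refine Measure.ext_of_charFunDual (funext fun L ↦ ?_)
  rw [charFunDual_sumLaw, charFunDual_sumLaw]
  exact e.prod_comp fun i ↦ charFunDual (m i) L

theorem sumLaw_eq_conv {ι : Type*} [Fintype ι] (m : ι → Measure E)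
    [∀ i, IsProbabilityMeasure (m i)] (p : ι → Prop) [DecidablePred p] :
    sumLaw m = sumLaw (fun i : {i // p i} ↦ m i) ∗ sumLaw (fun i : {i // ¬p i} ↦ m i) := by
  refine Measure.ext_of_charFunDual (funext fun L ↦ ?_)
  rw [charFunDual_conv, charFunDual_sumLaw, charFunDual_sumLaw, charFunDual_sumLaw,
    Fintype.prod_subtype_mul_prod_subtype p fun i ↦ charFunDual (m i) L]

theorem symNormTail_sumLaw_comp_le {ι κ : Type*} [Fintype ι] [Fintype κ] (m : ι → Measure E)
    [∀ i, IsProbabilityMeasure (m i)] {g : κ → ι} (hg : g.Injective) (t : ℝ) :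
    symNormTail (sumLaw (m ∘ g)) (2 * t) ≤ 2 * normTail (sumLaw m) t := by
  classical
  rw [sumLaw_eq_conv m fun i ↦ ∃ k, g k = i,
    ← sumLaw_comp_equiv (fun i : {i // ∃ k, g k = i} ↦ m i) (Equiv.ofInjective g hg)]
  exact symNormTail_two_mul_le _ _ t

/-- The sum of independent draws from the average of the laws `m k` is a uniform mixture: each
summand first picks an index, and `f` records the picks. -/
theorem normTail_sumLaw_average {n : ℕ} [NeZero n] (m : Fin n → Measure E)
    [∀ k, IsProbabilityMeasure (m k)] (mbar : Measure E) [IsProbabilityMeasure mbar]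
    (hbar : mbar = (n : ℝ≥0∞)⁻¹ • ∑ k, m k) (t : ℝ) :
    (n : ℝ) ^ n * normTail (sumLaw fun _ : Fin n ↦ mbar) t =
      ∑ f : Fin n → Fin n, normTail (sumLaw (m ∘ f)) t := by
  have hn : (n : ℂ) ≠ 0 := Nat.cast_ne_zero.2 (NeZero.ne n)
  have key : (n : ℝ≥0∞) ^ n • sumLaw (fun _ : Fin n ↦ mbar) =
      ∑ f : Fin n → Fin n, sumLaw (m ∘ f) := by
    have : IsFiniteMeasure ((n : ℝ≥0∞) ^ n • sumLaw (fun _ : Fin n ↦ mbar)) :=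
      Measure.smul_finite _ (by simp)
    refine Measure.ext_of_charFunDual (funext fun L ↦ ?_)
    have h2 : charFunDual ((n : ℝ≥0∞) ^ n • sumLaw (fun _ : Fin n ↦ mbar)) L =
        (n : ℂ) ^ n * charFunDual (sumLaw (fun _ : Fin n ↦ mbar)) L := by
      rw [charFunDual_apply, integral_smul_measure, charFunDual_apply]
      simp
    have h3 : charFunDual (∑ f : Fin n → Fin n, sumLaw (m ∘ f)) L =
        ∑ f : Fin n → Fin n, charFunDual (sumLaw (m ∘ f)) L := by
      rw [charFunDual_apply, integral_finsetSum_measure fun k _ ↦ integrable_exp_dual_mul_I _ _]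
      rfl
    rw [h2, h3, charFunDual_sumLaw, charFunDual_average m mbar hbar]
    simp_rw [charFunDual_sumLaw]
    rw [Finset.prod_const, Finset.card_univ, Fintype.card_fin, ← mul_pow,
      mul_inv_cancel_left₀ hn]
    have := Finset.prod_univ_sum (fun _ : Fin n ↦ (Finset.univ : Finset (Fin n)))
      (fun _ k ↦ charFunDual (m k) L)
    simpa using this
  have h := congrArg (fun ρ : Measure E ↦ ρ.real {x | t ≤ ‖x‖}) key
  simp only [measureReal_ennreal_smul_apply, ENNReal.toReal_pow, ENNReal.toReal_natCast] at h
  rw [normTail, h, measureReal_def, Measure.finsetSum_apply,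
    ENNReal.toReal_sum fun _ _ ↦ measure_ne_top _ _]
  rfl

end Laws

/-! ### Comparison of the laws of the two sums -/

section Comparison

variable {E : Type*} [NormedAddCommGroup E] [NormedSpace ℝ E]
  [MeasurableSpace E] [BorelSpace E] [SecondCountableTopology E]

/-- If the sum of draws from the average law is mostly small, then a center of concentration of
the sum of the `m k` is small too. Otherwise some functional `φ` and some frequency `u` would have
`u * φ a = π`, so that the characteristic function of the second sum is near `-1`, whereas the one
of the first sum is near `1` at all frequencies up to `u`. -/
theorem norm_center_lt {n : ℕ} [NeZero n] (m : Fin n → Measure E)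
    [∀ k, IsProbabilityMeasure (m k)] (mbar : Measure E) [IsProbabilityMeasure mbar]
    (hbar : mbar = (n : ℝ≥0∞)⁻¹ • ∑ k, m k) {t : ℝ} (ht : 0 < t)
    (hsmall : normTail (sumLaw fun _ : Fin n ↦ mbar) t < 1 / 100) {a : E}
    (ha : (sumLaw m).real {x | 4 * t ≤ ‖x - a‖} ≤ 16 / 100) : ‖a‖ < 100 * t := by
  by_contra! hR
  have hR0 : 0 < ‖a‖ := by linarith
  obtain ⟨φ, hφ, hφa⟩ := exists_dual_vector'' ℝ a
  set χ : Fin n → ℝ → ℂ := fun k u ↦ charFun ((m k).map φ) u with hχ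
  have hχ' (k u) : χ k u = charFunDual (m k) (u • φ) := charFun_map_eq_charFunDual_smul φ u
  have hprob (k) : IsProbabilityMeasure ((m k).map φ) :=
    Measure.isProbabilityMeasure_map (by fun_prop)
  have hU : ∀ u ∈ Set.Icc 0 (Real.pi / ‖a‖), u * t ≤ 4 / 100 := by
    intro u hu
    have h1 : u * ‖a‖ ≤ Real.pi := (le_div_iff₀ hR0).1 hu.2
    nlinarith [mul_le_mul_of_nonneg_left hR hu.1, Real.pi_lt_four]
  have hnorm {u : ℝ} (hu : 0 ≤ u) : ‖u • φ‖ ≤ u := by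
    rw [norm_smul, Real.norm_of_nonneg hu]
    exact mul_le_of_le_one_right hu hφ
  have hprod := norm_prod_sub_one_le_of_average_pow χ (fun k ↦ continuous_charFun)
    (fun k ↦ by simp [hχ]) (fun k u ↦ norm_charFun_le_one u) (U := Real.pi / ‖a‖) (by
      intro u hu
      have h1 : charFunDual (sumLaw fun _ : Fin n ↦ mbar) (u • φ) =
          ((n : ℂ)⁻¹ * ∑ k, χ k u) ^ n := by
        rw [charFunDual_sumLaw, Finset.prod_const, Finset.card_univ, Fintype.card_fin,
          charFunDual_average m mbar hbar]
        simp_rw [hχ']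
      have h2 := norm_charFunDual_sub_exp_le (sumLaw fun _ : Fin n ↦ mbar) (u • φ) 0 ht.le
      simp only [map_zero, Complex.ofReal_zero, zero_mul, Complex.exp_zero, sub_zero, h1] at h2
      have h3 := mul_le_mul_of_nonneg_right (hnorm hu.1) ht.le
      have h4 := hU u hu
      rw [normTail] at hsmall
      linarith)
  have hu : Real.pi / ‖a‖ ∈ Set.Icc 0 (Real.pi / ‖a‖) := ⟨by positivity, le_rfl⟩
  have h1 := hprod _ hu
  have h2 := norm_charFunDual_sub_exp_le (sumLaw m) ((Real.pi / ‖a‖) • φ) a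
    (by positivity : 0 ≤ 4 * t)
  have h3 : ((Real.pi / ‖a‖) • φ) a = Real.pi := by
    rw [smul_apply, hφa, smul_eq_mul]
    exact div_mul_cancel₀ _ hR0.ne'
  rw [h3, Complex.exp_pi_mul_I, charFunDual_sumLaw] at h2
  simp_rw [← hχ'] at h2
  have h4 := mul_le_mul_of_nonneg_right (hnorm hu.1) (by positivity : 0 ≤ 4 * t)
  have h5 := hU _ hu
  have h6 : (2 : ℝ) ≤ ‖∏ k, χ k (Real.pi / ‖a‖) - -1‖ + ‖∏ k, χ k (Real.pi / ‖a‖) - 1‖ := by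
    calc (2 : ℝ) = ‖(∏ k, χ k (Real.pi / ‖a‖) - -1) - (∏ k, χ k (Real.pi / ‖a‖) - 1)‖ := by
          norm_num
      _ ≤ _ := norm_sub_le _ _
  linarith

variable [CompleteSpace E]

theorem symNormTail_sumLaw_comp_le_of_mem_range {ι κ α : Type*} [Fintype ι] [Fintype κ]
    (m : α → Measure E) [∀ k, IsProbabilityMeasure (m k)] (f : ι → α) {j : κ → α}
    (hj : j.Injective) (hjf : ∀ k, j k ∈ Set.range f) (t : ℝ) :
    symNormTail (sumLaw (m ∘ j)) (2 * t) ≤ 2 * normTail (sumLaw (m ∘ f)) t := by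
  choose g hg using hjf
  have hfg : f ∘ g = j := funext hg
  subst hfg
  exact symNormTail_sumLaw_comp_le (m ∘ f) hj.of_comp t

/-- Split the indices into the range of `f` and its complement. The former is covered by `f`, the
latter by `τ ∘ f`. The permutation `τ` depends on `f` only, which permits relabeling `m`. -/
theorem symNormTail_sumLaw_le_of_card_image_ge {n : ℕ} (f : Fin n → Fin n)
    (hf : n ≤ 2 * (Finset.univ.image f).card) :
    ∃ τ : Equiv.Perm (Fin n), ∀ (m : Fin n → Measure E) [∀ k, IsProbabilityMeasure (m k)] (t : ℝ),
      symNormTail (sumLaw m) (4 * t) ≤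
        2 * normTail (sumLaw (m ∘ f)) t + 2 * normTail (sumLaw (m ∘ τ ∘ f)) t := by
  classical
  obtain ⟨τ, hτ⟩ := exists_perm_of_card_image_ge f hf
  refine ⟨τ, fun m _ t ↦ ?_⟩
  rw [sumLaw_eq_conv m fun k ↦ ∃ i, f i = k, show 4 * t = 2 * t + 2 * t by ring]
  exact (symNormTail_conv_le _ _ _ _).trans (add_le_add
    (symNormTail_sumLaw_comp_le_of_mem_range (κ := {k // ∃ i, f i = k}) m f
      Subtype.val_injective (fun k ↦ k.2) t)
    (symNormTail_sumLaw_comp_le_of_mem_range (κ := {k // ¬∃ i, f i = k}) m (τ ∘ f)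
      Subtype.val_injective (fun k ↦ hτ k k.2) t))

/-- The comparison for symmetrized sums: averaging over relabelings of the indices makes both
terms of the previous bound contribute equally. -/
theorem symNormTail_sumLaw_le {n : ℕ} [NeZero n] (m : Fin n → Measure E)
    [∀ k, IsProbabilityMeasure (m k)] (mbar : Measure E) [IsProbabilityMeasure mbar]
    (hbar : mbar = (n : ℝ≥0∞)⁻¹ • ∑ k, m k) (t : ℝ) :
    symNormTail (sumLaw m) (4 * t) ≤ 16 * normTail (sumLaw fun _ : Fin n ↦ mbar) t := by
  have hn : (0 : ℝ) < n := by exact_mod_cast NeZero.pos n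
  set p : (Fin n → Fin n) → ℝ := fun f ↦ normTail (sumLaw (m ∘ f)) t with hp
  have hp0 (f) : 0 ≤ p f := measureReal_nonneg
  set q := symNormTail (sumLaw m) (4 * t) with hq
  have hq0 : 0 ≤ q := measureReal_nonneg
  set good := Finset.univ.filter fun f : Fin n → Fin n ↦ n ≤ 2 * (Finset.univ.image f).card
  set N : ℝ := (Fintype.card (Equiv.Perm (Fin n)) : ℝ)
  have hN : 0 < N := Nat.cast_pos.2 Fintype.card_pos
  have hgood : ∀ f ∈ good, N * q ≤ 4 * ∑ π : Equiv.Perm (Fin n), p (π ∘ f) := by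
    intro f hf
    obtain ⟨τ, hτ⟩ := symNormTail_sumLaw_le_of_card_image_ge (E := E) f
      (Finset.mem_filter.1 hf).2
    have h1 (π : Equiv.Perm (Fin n)) : q ≤ 2 * p (π ∘ f) + 2 * p ((π * τ : Equiv.Perm _) ∘ f) := by
      rw [hq, ← sumLaw_comp_equiv m π]
      exact hτ (m ∘ π) t
    have h2 : ∑ π : Equiv.Perm (Fin n), p ((π * τ : Equiv.Perm _) ∘ f) =
        ∑ π : Equiv.Perm (Fin n), p (π ∘ f) :=
      Equiv.sum_comp (Equiv.mulRight τ) fun π : Equiv.Perm (Fin n) ↦ p (π ∘ f)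
    calc N * q = ∑ π : Equiv.Perm (Fin n), q := by simp [N]
      _ ≤ ∑ π : Equiv.Perm (Fin n), (2 * p (π ∘ f) + 2 * p ((π * τ : Equiv.Perm _) ∘ f)) :=
          Finset.sum_le_sum fun π _ ↦ h1 π
      _ = 4 * ∑ π : Equiv.Perm (Fin n), p (π ∘ f) := by
          rw [Finset.sum_add_distrib, ← Finset.mul_sum, ← Finset.mul_sum, h2]
          ring
  have hperm (π : Equiv.Perm (Fin n)) : ∑ f ∈ good, p (π ∘ f) ≤ ∑ f, p f := by
    rw [← (Equiv.arrowCongr (Equiv.refl (Fin n)) π).sum_comp p]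
    exact Finset.sum_le_sum_of_subset_of_nonneg (Finset.subset_univ _) fun _ _ _ ↦ hp0 _
  have htotal : (good.card : ℝ) * (N * q) ≤ 4 * (N * ∑ f, p f) := by
    calc (good.card : ℝ) * (N * q) = ∑ f ∈ good, N * q := by simp
      _ ≤ ∑ f ∈ good, 4 * ∑ π : Equiv.Perm (Fin n), p (π ∘ f) := Finset.sum_le_sum hgood
      _ = 4 * ∑ π : Equiv.Perm (Fin n), ∑ f ∈ good, p (π ∘ f) := by
          rw [← Finset.mul_sum, Finset.sum_comm]
      _ ≤ 4 * ∑ π : Equiv.Perm (Fin n), ∑ f, p f := by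
          gcongr with π
          exact hperm π
      _ = 4 * (N * ∑ f, p f) := by simp [N]
  have hcard := card_filter_card_image_ge n
  rw [hp, ← normTail_sumLaw_average m mbar hbar t] at htotal
  have h3 : (n : ℝ) ^ n * N * q ≤
      (n : ℝ) ^ n * N * (16 * normTail (sumLaw fun _ : Fin n ↦ mbar) t) := by
    have := mul_le_mul_of_nonneg_right hcard (mul_nonneg hN.le hq0)
    linarith
  exact le_of_mul_le_mul_left h3 (by positivity)

theorem normTail_sumLaw_le {n : ℕ} [NeZero n] (m : Fin n → Measure E)
    [∀ k, IsProbabilityMeasure (m k)] (mbar : Measure E) [IsProbabilityMeasure mbar]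
    (hbar : mbar = (n : ℝ≥0∞)⁻¹ • ∑ k, m k) {t : ℝ} (ht : 0 < t) :
    normTail (sumLaw m) (104 * t) ≤ 104 * normTail (sumLaw fun _ : Fin n ↦ mbar) t := by
  set p := normTail (sumLaw fun _ : Fin n ↦ mbar) t
  have hp0 : 0 ≤ p := measureReal_nonneg
  by_cases hsmall : p < 1 / 100
  -- `104 = 4 + 100`: the distance from the center plus the size of the center.
  · obtain ⟨a, ha⟩ := exists_measureReal_norm_sub_le_symNormTail (sumLaw m) (4 * t)
    have ha' := ha.trans (symNormTail_sumLaw_le m mbar hbar t)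
    have hlt := norm_center_lt m mbar hbar ht hsmall (ha'.trans (by linarith))
    have : normTail (sumLaw m) (104 * t) ≤ (sumLaw m).real {x | 4 * t ≤ ‖x - a‖} := by
      refine measureReal_mono fun x (hx : 104 * t ≤ ‖x‖) ↦ ?_
      have := norm_sub_norm_le x a
      simp only [Set.mem_ofPred_eq]
      linarith
    linarith
  · have : normTail (sumLaw m) (104 * t) ≤ 1 := measureReal_le_one
    linarith

end Comparison

/-! ### Passage from random variables to laws on a separable subspace -/

section Reduction

variable {Ω Ω' : Type*} [MeasurableSpace Ω] [MeasurableSpace Ω']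
  {μ : Measure Ω} {ν : Measure Ω'} {n : ℕ}

theorem RegularlyCovers.map_eq {E : Type*} [MeasurableSpace E] {X : Fin n → Ω → E} {Y : Ω' → E}
    (h : RegularlyCovers X μ Y ν) (hX : ∀ k, Measurable (X k)) (hY : Measurable Y) :
    ν.map Y = (n : ℝ≥0∞)⁻¹ • ∑ k, μ.map (X k) := by
  ext s hs
  have := h (s.indicator 1) (measurable_one.indicator hs)
  simp only [← lintegral_map (measurable_one.indicator hs) hY,
    ← lintegral_map (measurable_one.indicator hs) (hX _), lintegral_indicator_one hs] at this
  simpa using this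

theorem measureReal_norm_sum_eq_normTail {E : Type*} [NormedAddCommGroup E] [MeasurableSpace E]
    [BorelSpace E] [SecondCountableTopology E] [IsProbabilityMeasure μ] {X : Fin n → Ω → E}
    (hX : ∀ k, Measurable (X k)) (hind : iIndepFun X μ) (t : ℝ) :
    μ.real {ω | t ≤ ‖∑ k, X k ω‖} = normTail (sumLaw fun k ↦ μ.map (X k)) t := by
  rw [normTail, sumLaw, ← (iIndepFun_iff_map_fun_eq_pi_map fun k ↦ (hX k).aemeasurable).1 hind,
    Measure.map_map (by fun_prop) (by fun_prop), map_measureReal_apply (by fun_prop)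
      (measurableSet_le measurable_const measurable_norm)]
  rfl

theorem measureReal_norm_sum_le_of_secondCountable {E : Type*} [NormedAddCommGroup E]
    [NormedSpace ℝ E] [CompleteSpace E] [MeasurableSpace E] [BorelSpace E]
    [SecondCountableTopology E] [IsProbabilityMeasure μ] [IsProbabilityMeasure ν] [NeZero n]
    {X : Fin n → Ω → E} {Y : Fin n → Ω' → E} (hX : ∀ k, Measurable (X k))
    (hY : ∀ k, Measurable (Y k)) (hXind : iIndepFun X μ) (hYind : iIndepFun Y ν)
    (hcov : ∀ k, RegularlyCovers X μ (Y k) ν) {t : ℝ} (ht : 0 < t) :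
    μ.real {ω | 104 * t ≤ ‖∑ k, X k ω‖} ≤ 104 * ν.real {ω | t ≤ ‖∑ k, Y k ω‖} := by
  have hlaw (k) : ν.map (Y k) = ν.map (Y 0) := by
    rw [(hcov k).map_eq hX (hY k), (hcov 0).map_eq hX (hY 0)]
  have hprob (k) : IsProbabilityMeasure (μ.map (X k)) :=
    Measure.isProbabilityMeasure_map (hX k).aemeasurable
  have : IsProbabilityMeasure (ν.map (Y 0)) :=
    Measure.isProbabilityMeasure_map (hY 0).aemeasurable
  rw [measureReal_norm_sum_eq_normTail hX hXind, measureReal_norm_sum_eq_normTail hY hYind]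
  simp_rw [hlaw]
  exact normTail_sumLaw_le _ _ ((hcov 0).map_eq hX (hY 0)) ht

/-- The σ-algebra of a subtype is the trace of that of the ambient space, so independence can be
checked there. -/
theorem iIndepFun_of_iIndepFun_val {ι E : Type*} [MeasurableSpace E] {p : E → Prop}
    {Z : ι → Ω → Subtype p} (h : iIndepFun (fun i ω ↦ (Z i ω : E)) μ) : iIndepFun Z μ := by
  rw [iIndepFun_iff_iIndep] at h ⊢
  have hcomap (i) : MeasurableSpace.comap (Z i) inferInstance =
      MeasurableSpace.comap (fun ω ↦ (Z i ω : E)) inferInstance := MeasurableSpace.comap_comp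
  simpa only [hcomap] using h

/-- The general case: strongly measurable variables live, almost surely, in a separable closed
subspace, where addition is jointly measurable. -/
theorem measureReal_norm_sum_le {E : Type*} [NormedAddCommGroup E] [NormedSpace ℝ E]
    [CompleteSpace E] [MeasurableSpace E] [BorelSpace E] [IsProbabilityMeasure μ]
    [IsProbabilityMeasure ν] [NeZero n] {X : Fin n → Ω → E} {Y : Fin n → Ω' → E}
    (hX : ∀ k, AEStronglyMeasurable (X k) μ) (hY : ∀ k, AEStronglyMeasurable (Y k) ν)
    (hXind : iIndepFun X μ) (hYind : iIndepFun Y ν)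
    (hcov : ∀ k, RegularlyCovers X μ (Y k) ν) {t : ℝ} (ht : 0 < t) :
    μ.real {ω | 104 * t ≤ ‖∑ k, X k ω‖} ≤ 104 * ν.real {ω | t ≤ ‖∑ k, Y k ω‖} := by
  set X' : Fin n → Ω → E := fun k ↦ (hX k).mk
  set Y' : Fin n → Ω' → E := fun k ↦ (hY k).mk
  set S : Set E := (⋃ k, Set.range (X' k)) ∪ ⋃ k, Set.range (Y' k)
  have hSsep : TopologicalSpace.IsSeparable S :=
    (TopologicalSpace.IsSeparable.iUnion fun k ↦
      (hX k).stronglyMeasurable_mk.isSeparable_range).union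
    (TopologicalSpace.IsSeparable.iUnion fun k ↦
      (hY k).stronglyMeasurable_mk.isSeparable_range)
  set F : Submodule ℝ E := (Submodule.span ℝ S).topologicalClosure
  have hFclosed : IsClosed (F : Set E) := Submodule.isClosed_topologicalClosure _
  have hFsep : TopologicalSpace.IsSeparable (F : Set E) := (hSsep.span (R := ℝ)).closure
  have : TopologicalSpace.SeparableSpace F := hFsep.separableSpace
  have : SecondCountableTopology F := UniformSpace.secondCountable_of_separable F
  have : CompleteSpace F := hFclosed.completeSpace_coe
  have hSF : S ⊆ F := Submodule.subset_span.trans (Submodule.le_topologicalClosure _)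
  have hemb : MeasurableEmbedding (Subtype.val : F → E) :=
    MeasurableEmbedding.subtype_coe hFclosed.measurableSet
  set XF : Fin n → Ω → F := fun k ω ↦
    ⟨X' k ω, hSF (Or.inl (Set.mem_iUnion.2 ⟨k, ω, rfl⟩))⟩
  set YF : Fin n → Ω' → F := fun k ω ↦
    ⟨Y' k ω, hSF (Or.inr (Set.mem_iUnion.2 ⟨k, ω, rfl⟩))⟩
  have hXX' (k) : X k =ᵐ[μ] X' k := (hX k).ae_eq_mk
  have hYY' (k) : Y k =ᵐ[ν] Y' k := (hY k).ae_eq_mk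
  have hXF (k) : Measurable (XF k) := (hX k).stronglyMeasurable_mk.measurable.subtype_mk
  have hYF (k) : Measurable (YF k) := (hY k).stronglyMeasurable_mk.measurable.subtype_mk
  have hXFind : iIndepFun XF μ := iIndepFun_of_iIndepFun_val (hXind.congr hXX')
  have hYFind : iIndepFun YF ν := iIndepFun_of_iIndepFun_val (hYind.congr hYY')
  -- Extending test functions on `F` by zero transfers the covering property.
  have hcovF (k) : RegularlyCovers XF μ (YF k) ν := by
    intro g hg
    have h := hcov k (Function.extend Subtype.val g 0) (hemb.measurable_extend hg measurable_zero)
    have hg' (x : F) : Function.extend Subtype.val g 0 (x : E) = g x :=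
      Subtype.val_injective.extend_apply g 0 x
    have h1 : ∫⁻ ω, g (YF k ω) ∂ν = ∫⁻ ω, Function.extend Subtype.val g 0 (Y k ω) ∂ν :=
      lintegral_congr_ae ((hYY' k).mono fun ω hω ↦ by simp only [hω, ← hg']; rfl)
    have h2 (j) : ∫⁻ ω, g (XF j ω) ∂μ = ∫⁻ ω, Function.extend Subtype.val g 0 (X j ω) ∂μ :=
      lintegral_congr_ae ((hXX' j).mono fun ω hω ↦ by simp only [hω, ← hg']; rfl)
    simp_rw [h1, h2]
    exact h
  have key := measureReal_norm_sum_le_of_secondCountable hXF hYF hXFind hYFind hcovF ht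
  have hXsum : μ.real {ω | 104 * t ≤ ‖∑ k, X k ω‖} = μ.real {ω | 104 * t ≤ ‖∑ k, XF k ω‖} := by
    refine measureReal_congr ?_
    filter_upwards [ae_all_iff.2 hXX'] with ω hω
    refine propext ?_
    have hsum : ((∑ k, XF k ω : F) : E) = ∑ k, X k ω := by
      rw [Submodule.coe_sum]
      exact Finset.sum_congr rfl fun k _ ↦ (hω k).symm
    change 104 * t ≤ ‖∑ k, X k ω‖ ↔ 104 * t ≤ ‖((∑ k, XF k ω : F) : E)‖
    rw [hsum]
  have hYsum : ν.real {ω | t ≤ ‖∑ k, Y k ω‖} = ν.real {ω | t ≤ ‖∑ k, YF k ω‖} := by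
    refine measureReal_congr ?_
    filter_upwards [ae_all_iff.2 hYY'] with ω hω
    refine propext ?_
    have hsum : ((∑ k, YF k ω : F) : E) = ∑ k, Y k ω := by
      rw [Submodule.coe_sum]
      exact Finset.sum_congr rfl fun k _ ↦ (hω k).symm
    change t ≤ ‖∑ k, Y k ω‖ ↔ t ≤ ‖((∑ k, YF k ω : F) : E)‖
    rw [hsum]
  rwa [hXsum, hYsum]

end Reduction

theorem theorem1 :
    ∃ c : ℝ, 0 < c ∧
      ∀ (E : Type*) [NormedAddCommGroup E] [NormedSpace ℝ E] [CompleteSpace E]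
        [MeasurableSpace E] [BorelSpace E]
        (Ω : Type*) [MeasurableSpace Ω] (μ : Measure Ω) [IsProbabilityMeasure μ]
        (Ω' : Type*) [MeasurableSpace Ω'] (ν : Measure Ω') [IsProbabilityMeasure ν]
        (n : ℕ) [NeZero n] (X : Fin n → Ω → E) (Y : Fin n → Ω' → E),
        (∀ k, AEStronglyMeasurable (X k) μ) →
        (∀ k, AEStronglyMeasurable (Y k) ν) →
        iIndepFun X μ →
        RegularlyCovers X μ (Y 0) ν →
        iIndepFun Y ν →
        (∀ k, IdentDistrib (Y k) (Y 0) ν ν) →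
        ∀ t : ℝ, 0 ≤ t →
          μ.real {ω | t ≤ ‖∑ k, X k ω‖} ≤ c * ν.real {ω | t / c ≤ ‖∑ k, Y k ω‖} := by
  refine ⟨104, by norm_num, ?_⟩
  intro E _ _ _ _ _ Ω _ μ _ Ω' _ ν _ n _ X Y hX hY hXind hcov hYind hident t ht
  have hcov' (k) : RegularlyCovers X μ (Y k) ν := by
    intro g hg
    rw [← hcov g hg]
    exact ((hident k).comp hg).lintegral_eq
  rcases ht.eq_or_lt with rfl | ht
  · simp
  · have := measureReal_norm_sum_le hX hY hXind hYind hcov' (t := t / 104) (by positivity)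
    rwa [mul_div_cancel₀ t (by norm_num)] at this
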